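/- Let $n,m,k$ be integers with $n\ge 1$, $m\ge n+1$ and $1\le k\le m$, and let $A\in\mathbb R^{n\times m}$ have rank $n$. For $S\subset\{1,\dots,m\}$ let $A_S$ denote the submatrix of $A$ formed by the columns indexed by $S$. For a real $p\times q$ matrix $M$ let $\sigma_{\min}(M)$ be its $\min\{p,q\}$-th largest singular value, that is, $\sigma_{\min}(M)=\min\{\|Mx\|_2 : x\in\mathbb R^q,\ \|x\|_2=1\}$ if $q\le p$ and $\sigma_{\min}(M)=\min\{\|M^{\top}x\|_2 : x\in\mathbb R^p,\ \|x\|_2=1\}$ if $q>p$. Then there exists $S_0\subset\{1,\dots,m\}$ of size $k$ such that $$\sigma_{\min}(A_{S_0})^2\ \ge\ \frac{|n-k|+1}{\alpha\cdot(\min\{k,n\}\cdot m-nk)+|n-k|+1}\ \sigma_{\min}(A)^2,$$ where $$\alpha=\alpha_{m,n,k}=\begin{cases}\frac12+\frac12\,(1-h_1(m,n,k))^{1/2} & \text{if } m\ge n+k \text{ and } k\le n,\\ \frac12+\frac12\,(1-h_1(m,k,n))^{1/2} & \text{if } m\ge n+k \text{ and } k\ge n,\\ \frac12+\frac12\,(1-h_2(m,n,k))^{1/2}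 & \text{if } m\le n+k \text{ and } k\le n,\\ \frac12+\frac12\,(1-h_2(m,k,n))^{1/2} & \text{if } m\le n+k \text{ and } k\ge n,\end{cases}$$ with $$h_1(m,x_2,x_3)=4\cdot\frac{x_3-1}{x_3^2}\cdot\left(1-\frac{(x_3-1)(m-x_3+1)}{(m-x_2)\,x_2}\right),\qquad h_2(m,x_2,x_3)=4\cdot\frac{(x_2+1-x_3)(m-x_2-1)(x_2+x_3+1-m)}{(m-x_3)\,x_3\,(m-x_2)^2}.$$ (The cases agree where they overlap. If $k=m$, the formula for $h_2(m,k,n)$ has denominator $0$, but $\alpha$ is then multiplied by $\min\{k,n\}\cdot m-nk=0$; that product is read as $0$, so the bound is $\sigma_{\min}(A_{S_0})^2\ge\sigma_{\min}(A)^2$.) -/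

import Mathlib

noncomputable section

/-- The submatrix `A_S` formed by the columns of `A` indexed by `S`. -/
def columnSubmatrix {n m : ℕ} (A : Matrix (Fin n) (Fin m) ℝ) (S : Finset (Fin m)) :
    Matrix (Fin n) S ℝ :=
  A.submatrix id (fun j : S => (j : Fin m))

/-- The smallest value of `‖M x‖₂` over Euclidean unit vectors `x`. The unit sphere is compact, so
the infimum is a minimum as soon as `M` has at least one column. -/
def minStretch {ι κ : Type*} [Fintype ι] [Fintype κ] (M : Matrix ι κ ℝ) : ℝ :=
  ⨅ x : Metric.sphere (0 : EuclideanSpace ℝ κ) 1,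
    ‖(WithLp.toLp 2 (M.mulVec (x : EuclideanSpace ℝ κ).ofLp) : EuclideanSpace ℝ ι)‖

/-- `σ_min(M)`, the `min {p, q}`-th largest singular value of a `p × q` matrix `M`: the minimum of
`‖M x‖₂` over unit vectors if `q ≤ p`, and the minimum of `‖Mᵀ x‖₂` over unit vectors if
`p < q`. -/
def sigmaMin {ι κ : Type*} [Fintype ι] [Fintype κ] (M : Matrix ι κ ℝ) : ℝ :=
  if Fintype.card κ ≤ Fintype.card ι then minStretch M else minStretch M.transpose

/-- The function `h₁(m, x₂, x₃)`. -/
def hOne (m x₂ x₃ : ℝ) : ℝ :=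
  4 * ((x₃ - 1) / x₃ ^ 2) * (1 - ((x₃ - 1) * (m - x₃ + 1)) / ((m - x₂) * x₂))

/-- The function `h₂(m, x₂, x₃)`. -/
def hTwo (m x₂ x₃ : ℝ) : ℝ :=
  4 * (((x₂ + 1 - x₃) * (m - x₂ - 1) * (x₂ + x₃ + 1 - m)) /
    ((m - x₃) * x₃ * (m - x₂) ^ 2))

/-- The constant `α_{m,n,k}`. The four cases `m ≥ n + k` or `m ≤ n + k`, and `k ≤ n` or `k ≥ n`,
give the same value where they overlap. For `k = m` the fraction in `h₂` is `0 / 0`, but then `α`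
is only ever multiplied by `min {k, n} * m - n * k = 0`. -/
def alphaConst (m n k : ℕ) : ℝ :=
  if n + k ≤ m then
    if k ≤ n then 1 / 2 + 1 / 2 * Real.sqrt (1 - hOne m n k)
    else 1 / 2 + 1 / 2 * Real.sqrt (1 - hOne m k n)
  else
    if k ≤ n then 1 / 2 + 1 / 2 * Real.sqrt (1 - hTwo m n k)
    else 1 / 2 + 1 / 2 * Real.sqrt (1 - hTwo m k n)

end

/-!
Write `P` for the orthogonal projection onto the row space of `A` and `σ` for `sigmaMin A`. If
`k ≤ n` and the principal submatrix `P_S` has all eigenvalues at least `ρ`, then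
`‖A v‖ ≥ σ ‖P v‖` gives `sigmaMin (A_S) ^ 2 ≥ ρ σ ^ 2`. If `k > n`, the same conclusion holds when
the principal submatrix of `1 - P` indexed by the *complement* of `S` has all eigenvalues at least
`ρ`. Replacing `(P, n, k)` by `(1 - P, m - n, m - k)` exchanges `hOne` and `hTwo` and reduces the
second case to the first; for `k = m` all columns are taken.

So let `k ≤ n`, with `1 ≤ k` and `n < m`. A good principal submatrix is found by the method of
interlacing polynomials: the derivative of the characteristic polynomial of a symmetric matrix is
the sum of the characteristic polynomials of its principal submatrices of corank one, and all their
derivatives interlace those of the big characteristic polynomial. Interlacing is used in the form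
that a quotient of two polynomials is decreasing, a Wronskian inequality which follows from the
spectral theorem and Laguerre's inequality (`wronskian_charpoly_submatrix_le`). Deleting one index
at a time, `exists_submatrix_charpoly_pos` produces an `S` for which the extreme root of the
characteristic polynomial is no worse than that of
`p = derivative^[m - k] (X ^ (m - n) * (X + 1) ^ n)` (signs are changed, so that the smallest
eigenvalue becomes the largest root).

It remains to bound the roots `ρ` of this Jacobi polynomial. In the variable `y = -(1 + ρ) / ρ ≥ 0`
the sum `s` of all roots and the sum `t` of the reciprocals of the `d` nonzero ones can be read off
from the coefficients of `p` at `0` and at `-1`. The inequality between arithmetic and harmonic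
mean for the other nonzero roots shows that the largest root satisfies `y (s - y) ≥ (d - 1) s / t`
as soon as `y ≥ s / 2`, hence `y ≤ α s` (`le_of_sum_of_sum_inv`). Here `d = k` if `n + k ≤ m` and
`d = m - n` otherwise, which accounts for the two functions `hOne` and `hTwo`.
-/

/-! ### Real-rooted polynomials and decreasing quotients -/

open Polynomial in
theorem splits_derivative {p : ℝ[X]} (hp : p.Splits) : (derivative p).Splits := by
  rw [splits_iff_card_roots]
  refine le_antisymm (card_roots' _) ?_
  have h1 := card_roots_le_derivative p
  rw [splits_iff_card_roots.1 hp] at h1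
  have h2 := natDegree_derivative_le p
  omega

open Polynomial in
theorem splits_iterate_derivative {p : ℝ[X]} (hp : p.Splits) (N : ℕ) :
    (derivative^[N] p).Splits := by
  induction N with
  | zero => exact hp
  | succ N ih => rw [Function.iterate_succ_apply']; exact splits_derivative ih

open Polynomial in
/-- Laguerre's inequality for real-rooted polynomials. -/
theorem eval_mul_eval_derivative_derivative_le_sq {p : ℝ[X]} (hp : p.Splits) (x : ℝ) :
    p.eval x * (derivative (derivative p)).eval x ≤ (derivative p).eval x ^ 2 := by
  obtain ⟨R, hR⟩ := splits_iff_exists_multiset.1 hp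
  have key : ∀ R : Multiset ℝ, ∀ q : ℝ[X], q = (R.map (X - C ·)).prod →
      q.eval x * (derivative (derivative q)).eval x ≤ (derivative q).eval x ^ 2 := by
    intro R
    induction R using Multiset.induction_on with
    | empty => rintro q rfl; simp
    | cons a R ih =>
      rintro q rfl
      have h := ih _ rfl
      simp only [Multiset.map_cons, Multiset.prod_cons, derivative_mul, derivative_sub,
        derivative_X, derivative_C, derivative_add, derivative_one, derivative_zero,
        eval_add, eval_mul, eval_sub, eval_X, eval_C, eval_one, eval_zero]
      set v := (R.map (X - C ·)).prod with hv
      nlinarith [mul_le_mul_of_nonneg_left h (sq_nonneg (x - a)), sq_nonneg (v.eval x)]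
  have h := key R _ rfl
  rw [hR]
  simp only [derivative_C_mul, eval_C_mul]
  nlinarith [mul_le_mul_of_nonneg_left h (sq_nonneg p.leadingCoeff)]

open Polynomial in
/-- If `f = (X - t) h` is real-rooted, then the quotient of the `N`-th derivatives of `h` and `f`
has nonpositive derivative, because of Laguerre's inequality for the `(N - 1)`-st derivative of
`h`. -/
theorem wronskian_iterate_derivative_le {h : ℝ[X]} (hh : h.Splits) (t : ℝ) (N : ℕ) (x : ℝ) :
    (derivative (derivative^[N] h)).eval x * (derivative^[N] ((X - C t) * h)).eval x -
      (derivative^[N] h).eval x * (derivative (derivative^[N] ((X - C t) * h))).eval x ≤ 0 := by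
  have hD : ∀ M : ℕ, derivative^[M + 1] ((X - C t) * h) =
      (X - C t) * derivative^[M + 1] h + (M + 1 : ℝ[X]) * derivative^[M] h := by
    intro M
    induction M with
    | zero => simp; ring
    | succ M ih =>
      rw [Function.iterate_succ_apply', ih, Function.iterate_succ_apply' _ (M + 1),
        Function.iterate_succ_apply' _ M]
      simp [derivative_mul]
      ring
  cases N with
  | zero =>
    simp only [Function.iterate_zero, id, derivative_mul, derivative_sub, derivative_X,
      derivative_C, eval_add, eval_mul, eval_sub, eval_X, eval_C, eval_one, eval_zero]
    nlinarith [sq_nonneg (h.eval x)]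
  | succ M =>
    have hL := eval_mul_eval_derivative_derivative_le_sq (splits_iterate_derivative hh M) x
    rw [hD M, Function.iterate_succ_apply']
    simp only [derivative_mul, derivative_sub, derivative_X, derivative_C, derivative_add,
      derivative_one, derivative_natCast, eval_add, eval_mul, eval_sub, eval_X, eval_C, eval_one,
      eval_zero, eval_natCast]
    have hM : (0 : ℝ) ≤ M := Nat.cast_nonneg M
    nlinarith [mul_le_mul_of_nonneg_left hL hM,
      sq_nonneg ((derivative (derivative^[M] h)).eval x)]

open Polynomial Filter Topology Set in
/-- Let `g / G` be decreasing wherever it is defined and let `G` be strictly increasing on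
`[r, ∞)`. If `g` is nonnegative at `r` and positive near infinity, then `g` is positive on
`(r, ∞)`. -/
theorem eval_pos_of_wronskian_le {g G : ℝ[X]} {r : ℝ}
    (hW : ∀ x, (derivative g).eval x * G.eval x - g.eval x * (derivative G).eval x ≤ 0)
    (hG : ∀ x, r < x → 0 < (derivative G).eval x) (hgr : 0 ≤ g.eval r)
    (hg : ∀ᶠ x in atTop, 0 < g.eval x) : ∀ x, r < x → 0 < g.eval x := by
  have hmono : StrictMonoOn (fun x => G.eval x) (Ici r) := by
    refine strictMonoOn_of_deriv_pos (convex_Ici r) G.continuous.continuousOn ?_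
    intro x hx
    rw [interior_Ici] at hx
    rw [Polynomial.deriv]
    exact hG x hx
  have hanti : ∀ x y, x ≤ y → (∀ z ∈ Icc x y, G.eval z ≠ 0) →
      g.eval y / G.eval y ≤ g.eval x / G.eval x := by
    intro x y hxy hne
    have : AntitoneOn (fun z => g.eval z / G.eval z) (Icc x y) := by
      refine antitoneOn_of_deriv_nonpos (convex_Icc x y)
        (g.continuous.continuousOn.div G.continuous.continuousOn hne) ?_ ?_
      · intro z hz
        have hz' := hne z (interior_subset hz)
        exact ((g.differentiable z).div (G.differentiable z) hz').differentiableWithinAt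
      · intro z hz
        have hz' := hne z (interior_subset hz)
        rw [((g.hasDerivAt z).fun_div (G.hasDerivAt z) hz').deriv]
        exact div_nonpos_of_nonpos_of_nonneg (hW z) (sq_nonneg _)
    exact this (left_mem_Icc.2 hxy) (right_mem_Icc.2 hxy) hxy
  have hposG : ∀ x, r ≤ x → 0 < G.eval x → 0 < g.eval x := by
    intro x hx hGx
    obtain ⟨y, hy, hxy⟩ := (hg.and (eventually_ge_atTop x)).exists
    have hpos : ∀ z, x ≤ z → 0 < G.eval z := fun z hz =>
      hGx.trans_le (hmono.monotoneOn hx (hx.trans hz) hz)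
    have h := hanti x y hxy fun z hz => (hpos z hz.1).ne'
    exact (div_pos_iff_of_pos_right hGx).1 ((div_pos hy (hpos y hxy)).trans_le h)
  have hnegG : ∀ x, r < x → G.eval x < 0 → 0 < g.eval x := by
    intro x hx hGx
    by_contra! hcon
    have hneg : ∀ z, r ≤ z → z ≤ x → G.eval z < 0 := fun z hz hzx =>
      (hmono.monotoneOn hz hx.le hzx).trans_lt hGx
    have hzero : ∀ y ∈ Icc r x, g.eval y = 0 := by
      intro y hy
      have h1 := hanti y x hy.2 fun z hz => (hneg z (hy.1.trans hz.1) hz.2).ne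
      have h2 := hanti r y hy.1 fun z hz => (hneg z hz.1 (hz.2.trans hy.2)).ne
      have h3 : g.eval r / G.eval r ≤ 0 :=
        div_nonpos_of_nonneg_of_nonpos hgr (hneg r le_rfl hx.le).le
      have h4 : 0 ≤ g.eval x / G.eval x := div_nonneg_of_nonpos hcon hGx.le
      have h5 : g.eval y / G.eval y = 0 := le_antisymm (h2.trans h3) (h4.trans h1)
      exact (div_eq_zero_iff.1 h5).resolve_right (hneg y hy.1 hy.2).ne
    have : g = 0 := by
      refine eq_zero_of_infinite_isRoot g ((Icc_infinite hx).mono hzero)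
    obtain ⟨y, hy⟩ := hg.exists
    simp [this] at hy
  intro x hx
  rcases lt_trichotomy (G.eval x) 0 with hGx | hGx | hGx
  · exact hnegG x hx hGx
  · by_contra! hcon
    have hG' := hG x hx
    have hgx : g.eval x = 0 := by
      have := hW x
      rw [hGx] at this
      nlinarith
    -- `x` is a local minimum of `g`, so `g / G` would tend to `0` at `x` from the right and then
    -- decrease, although it is positive there.
    have hmin : IsLocalMin (fun y => g.eval y) x := by
      filter_upwards [lt_mem_nhds hx] with y hy
      rw [hgx]
      rcases lt_trichotomy y x with h | h | h
      · exact (hnegG y hy (hGx ▸ hmono hy.le hx.le h)).le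
      · rw [h, hgx]
      · exact (hposG y hy.le (hGx ▸ hmono hx.le hy.le h)).le
    have hg' : (derivative g).eval x = 0 := hmin.hasDerivAt_eq_zero (g.hasDerivAt x)
    have hpos : ∀ y, x < y → 0 < G.eval y := fun y hy =>
      hGx ▸ hmono hx.le (hx.trans hy).le hy
    have hlim : Tendsto (fun y => g.eval y / G.eval y) (𝓝[>] x) (𝓝 0) := by
      have h1 := (hasDerivAt_iff_tendsto_slope.1 (g.hasDerivAt x)).mono_left
        (nhdsWithin_mono x (fun y (hy : x < y) => hy.ne'))
      have h2 := (hasDerivAt_iff_tendsto_slope.1 (G.hasDerivAt x)).mono_left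
        (nhdsWithin_mono x (fun y (hy : x < y) => hy.ne'))
      have h3 := h1.div h2 hG'.ne'
      rw [hg', zero_div] at h3
      refine h3.congr' ?_
      filter_upwards [self_mem_nhdsWithin] with y hy
      have hyx : y - x ≠ 0 := sub_ne_zero.2 (ne_of_gt hy)
      simp only [Pi.div_apply, slope_def_field, hgx, hGx, sub_zero]
      rw [div_div_div_cancel_right₀ hyx]
    have hy : x < x + 1 := by linarith
    have hle : g.eval (x + 1) / G.eval (x + 1) ≤ 0 := by
      refine ge_of_tendsto hlim ?_
      filter_upwards [Ioo_mem_nhdsGT hy] with z hz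
      exact hanti z (x + 1) hz.2.le fun w hw => (hpos w (hz.1.trans_le hw.1)).ne'
    exact absurd hle (not_le.2 (div_pos (hposG _ (hx.trans hy).le (hpos _ hy)) (hpos _ hy)))
  · exact hposG x hx.le hGx

/-! ### Interlacing for principal submatrices -/

open Polynomial Matrix in
/-- The characteristic polynomial of a principal submatrix of corank one is a nonnegative
combination of the polynomials `f / (X - λ)`, where `f` is the characteristic polynomial of the
whole matrix and `λ` runs over the eigenvalues. -/
theorem charpoly_submatrix_succAbove {s : ℕ} {A : Matrix (Fin (s + 1)) (Fin (s + 1)) ℝ}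
    (hA : A.IsHermitian) (i : Fin (s + 1)) :
    (A.submatrix i.succAbove i.succAbove).charpoly =
      ∑ j, C (hA.eigenvectorUnitary.1 i j ^ 2) *
        ∏ l ∈ Finset.univ.erase j, (X - C (hA.eigenvalues l)) := by
  set U : Matrix (Fin (s + 1)) (Fin (s + 1)) ℝ := hA.eigenvectorUnitary.1 with hU
  have hUU : U * Uᵀ = 1 := by
    have := Unitary.coe_mul_star_self hA.eigenvectorUnitary
    rwa [Unitary.coe_star, star_eq_conjTranspose, conjTranspose_eq_transpose_of_trivial] at this
  have hspec : A = U * diagonal hA.eigenvalues * Uᵀ := by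
    have := hA.spectral_theorem
    rw [Unitary.conjStarAlgAut_apply, star_eq_conjTranspose,
      conjTranspose_eq_transpose_of_trivial] at this
    exact this
  set V : Matrix (Fin (s + 1)) (Fin (s + 1)) ℝ[X] := U.map C with hV
  have hVV : V * Vᵀ = 1 := by
    rw [hV, ← transpose_map, ← Matrix.map_mul, hUU, Matrix.map_one _ C_0 C_1]
  have hchar : charmatrix A = V * charmatrix (diagonal hA.eigenvalues) * Vᵀ := by
    conv_lhs => rw [hspec]
    simp only [charmatrix, RingHom.mapMatrix_apply, Matrix.map_mul]
    rw [mul_sub, sub_mul, transpose_map, ← hV, ← (scalar_commute _ (Commute.all _) V).eq,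
      mul_assoc (scalar _ _), hVV, mul_one]
  have hadj : ∀ W : Matrix (Fin (s + 1)) (Fin (s + 1)) ℝ[X], W * Wᵀ = 1 →
      adjugate W = W.det • Wᵀ := by
    intro W hW
    calc adjugate W = adjugate W * (W * Wᵀ) := by rw [hW, mul_one]
      _ = W.det • Wᵀ := by rw [← mul_assoc, adjugate_mul, smul_mul, one_mul]
  have hdet : V.det * Vᵀ.det = 1 := by rw [← det_mul, hVV, det_one]
  have h1 : (A.submatrix i.succAbove i.succAbove).charpoly = adjugate (charmatrix A) i i := by
    rw [adjugate_fin_succ_eq_det_submatrix, ← two_mul, pow_mul, neg_one_sq, one_pow, one_mul,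
      charpoly]
    congr 1
    ext a b
    simp [charmatrix_apply, diagonal_apply]
  have h2 : adjugate (charmatrix A) = V * diagonal (fun j =>
      ∏ l ∈ Finset.univ.erase j, (X - C (hA.eigenvalues l))) * Vᵀ := by
    rw [hchar, charmatrix_diagonal, adjugate_mul_distrib, adjugate_mul_distrib,
      hadj _ hVV, hadj Vᵀ (by rw [transpose_transpose]; exact mul_eq_one_comm.1 hVV), transpose_transpose, adjugate_diagonal]
    simp only [smul_mul_assoc, mul_smul_comm, smul_smul]
    rw [hdet, one_smul, mul_assoc]
  rw [h1, h2, mul_apply]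
  refine Finset.sum_congr rfl fun j _ => ?_
  rw [mul_diagonal, hV, transpose_apply, map_apply, C_pow]
  ring

open Polynomial Matrix in
/-- The derivative of the characteristic polynomial is the sum of the characteristic polynomials of
the principal submatrices of corank one. -/
theorem derivative_charpoly_eq_sum {s : ℕ} {A : Matrix (Fin (s + 1)) (Fin (s + 1)) ℝ}
    (hA : A.IsHermitian) :
    derivative A.charpoly = ∑ i : Fin (s + 1), (A.submatrix i.succAbove i.succAbove).charpoly := by
  simp_rw [charpoly_submatrix_succAbove hA]
  rw [Finset.sum_comm, hA.charpoly_eq]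
  simp_rw [← Finset.sum_mul, ← map_sum]
  rw [derivative_prod_finset]
  refine Finset.sum_congr rfl fun j _ => ?_
  have : ∑ i, hA.eigenvectorUnitary.1 i j ^ 2 = 1 := by
    have h := congrFun (congrFun (Unitary.coe_star_mul_self hA.eigenvectorUnitary) j) j
    rw [star_eq_conjTranspose, conjTranspose_eq_transpose_of_trivial, mul_apply, one_apply_eq] at h
    rw [← h]
    exact Finset.sum_congr rfl fun i _ => sq _
  rw [this]
  simp

open Polynomial Matrix in
/-- The `N`-th derivatives of the characteristic polynomials of a symmetric matrix and of a
principal submatrix of corank one interlace: their quotient is decreasing. -/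
theorem wronskian_charpoly_submatrix_le {s : ℕ} {A : Matrix (Fin (s + 1)) (Fin (s + 1)) ℝ}
    (hA : A.IsHermitian) (i : Fin (s + 1)) (N : ℕ) (x : ℝ) :
    (derivative (derivative^[N] (A.submatrix i.succAbove i.succAbove).charpoly)).eval x *
        (derivative^[N] A.charpoly).eval x -
      (derivative^[N] (A.submatrix i.succAbove i.succAbove).charpoly).eval x *
        (derivative (derivative^[N] A.charpoly)).eval x ≤ 0 := by
  rw [charpoly_submatrix_succAbove hA, iterate_derivative_sum, derivative_sum, eval_finsetSum,
    eval_finsetSum, Finset.sum_mul, Finset.sum_mul, ← Finset.sum_sub_distrib]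
  refine Finset.sum_nonpos fun j _ => ?_
  have hf : A.charpoly = (X - C (hA.eigenvalues j)) *
      ∏ l ∈ Finset.univ.erase j, (X - C (hA.eigenvalues l)) := by
    rw [hA.charpoly_eq]
    exact (Finset.mul_prod_erase _ _ (Finset.mem_univ j)).symm
  have h := wronskian_iterate_derivative_le
    (h := ∏ l ∈ Finset.univ.erase j, (X - C (hA.eigenvalues l)))
    (Splits.prod fun l _ => Splits.X_sub_C _) (hA.eigenvalues j) N x
  rw [← hf] at h
  rw [iterate_derivative_C_mul, derivative_C_mul, eval_C_mul, eval_C_mul, mul_assoc, mul_assoc,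
    ← mul_sub]
  exact mul_nonpos_of_nonneg_of_nonpos (sq_nonneg _) h

open Polynomial Filter in
theorem eventually_eval_iterate_derivative_pos {p : ℝ[X]} (hp : p.Monic) {N : ℕ}
    (hN : N ≤ p.natDegree) : ∀ᶠ x in atTop, 0 < (derivative^[N] p).eval x := by
  have h : 0 < (derivative^[N] p).leadingCoeff := by
    have hdeg : ∀ M ≤ p.natDegree, (derivative^[M] p).natDegree = p.natDegree - M ∧
        0 < (derivative^[M] p).leadingCoeff := by
      intro M
      induction M with
      | zero => simp [hp.leadingCoeff]
      | succ M ih =>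
        intro hM
        obtain ⟨h1, h2⟩ := ih (by omega)
        rw [Function.iterate_succ_apply', natDegree_derivative, leadingCoeff_derivative, h1]
        refine ⟨by omega, mul_pos h2 ?_⟩
        exact_mod_cast Nat.sub_pos_of_lt hM
    exact (hdeg N hN).2
  by_cases! hdeg : (derivative^[N] p).degree ≤ 0
  · have hc := eq_C_of_degree_le_zero hdeg
    rw [hc, leadingCoeff_C] at h
    rw [hc]
    exact Eventually.of_forall fun x => by rwa [eval_C]
  · exact (tendsto_atTop_of_leadingCoeff_nonneg _ hdeg h.le).eventually_gt_atTop 0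

open Polynomial Matrix in
/-- If a derivative of degree `k` of the characteristic polynomial of a symmetric matrix is
positive to the right of `r`, then so is the characteristic polynomial of some `k × k` principal
submatrix: deleting the rows and columns one at a time, some deletion always does not increase
the largest root of the relevant derivative. -/
theorem exists_submatrix_charpoly_pos {k : ℕ} {r : ℝ} (N : ℕ)
    {A : Matrix (Fin (k + N)) (Fin (k + N)) ℝ} (hA : A.IsHermitian)
    (h : ∀ x, r < x → 0 < (derivative^[N] A.charpoly).eval x) :
    ∃ e : Fin k ↪ Fin (k + N), ∀ x, r < x → 0 < (A.submatrix e e).charpoly.eval x := by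
  induction N with
  | zero => exact ⟨Function.Embedding.refl _, h⟩
  | succ N ih =>
    have hsum : derivative (derivative^[N] A.charpoly) = ∑ i : Fin (k + N + 1),
        derivative^[N] (A.submatrix i.succAbove i.succAbove).charpoly := by
      rw [← Function.iterate_succ_apply' derivative, Function.iterate_succ_apply,
        derivative_charpoly_eq_sum (s := k + N) hA, iterate_derivative_sum]
    rw [Function.iterate_succ_apply'] at h
    have hr : 0 ≤ (derivative (derivative^[N] A.charpoly)).eval r := by
      refine ge_of_tendsto (x := nhdsWithin r (Set.Ioi r))
        ((Polynomial.continuous _).continuousAt.mono_left inf_le_left) ?_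
      filter_upwards [self_mem_nhdsWithin] with x hx using (h x hx).le
    obtain ⟨i, hi⟩ : ∃ i : Fin (k + N + 1),
        0 ≤ (derivative^[N] (A.submatrix i.succAbove i.succAbove).charpoly).eval r := by
      by_contra! hcon
      rw [hsum, eval_finsetSum] at hr
      exact absurd hr (not_le.2 (Finset.sum_neg (fun i _ => hcon i) Finset.univ_nonempty))
    obtain ⟨e, he⟩ := ih (A := A.submatrix i.succAbove i.succAbove) (hA.submatrix _)
      (eval_pos_of_wronskian_le (wronskian_charpoly_submatrix_le (s := k + N) hA i N) h hi
        (eventually_eval_iterate_derivative_pos (charpoly_monic _) (by simp)))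
    exact ⟨e.trans i.succAboveEmb, he⟩

/-! ### Root bounds from arithmetic and harmonic means -/

theorem card_sq_le_sum_mul_sum_inv (Y : Multiset ℝ) (hY : ∀ y ∈ Y, 0 < y) :
    (Multiset.card Y : ℝ) ^ 2 ≤ Y.sum * (Y.map (·⁻¹)).sum := by
  induction Y using Multiset.induction_on with
  | empty => simp
  | cons y Y ih =>
    have hy := hY y (Multiset.mem_cons_self y Y)
    have ih := ih fun z hz => hY z (Multiset.mem_cons_of_mem hz)
    have hσ : 0 ≤ Y.sum :=
      Multiset.sum_nonneg fun z hz => (hY z (Multiset.mem_cons_of_mem hz)).le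
    have hτ : 0 ≤ (Y.map (·⁻¹)).sum := by
      refine Multiset.sum_nonneg fun z hz => ?_
      obtain ⟨w, hw, rfl⟩ := Multiset.mem_map.1 hz
      exact (inv_pos.2 (hY w (Multiset.mem_cons_of_mem hw))).le
    simp only [Multiset.card_cons, Multiset.sum_cons, Multiset.map_cons, Nat.cast_add,
      Nat.cast_one]
    set σ := Y.sum
    set τ := (Y.map (·⁻¹)).sum
    have hyy : y * y⁻¹ = 1 := mul_inv_cancel₀ hy.ne'
    have h1 : (2 * (Multiset.card Y : ℝ)) ≤ y * τ + σ * y⁻¹ := by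
      refine abs_le_of_sq_le_sq' ?_ ?_ |>.2
      · have : y * τ * (σ * y⁻¹) = σ * τ := by
          linear_combination (σ * τ) * hyy
        nlinarith [sq_nonneg (y * τ - σ * y⁻¹)]
      · positivity
    nlinarith

/-- If positive numbers have sum `s` and sum of reciprocals `t`, then each of them is bounded by
the larger solution `z` of `z (s - z) = (d - 1) s / t`, where `d` is their number. This is the
inequality between arithmetic and harmonic mean for the other `d - 1` numbers. -/
theorem le_of_sum_of_sum_inv {Y : Multiset ℝ} (hY : ∀ y ∈ Y, 0 < y) {y : ℝ} (hy : y ∈ Y) :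
    y ≤ Y.sum * (1 / 2 + 1 / 2 * Real.sqrt
      (1 - 4 * ((Multiset.card Y : ℝ) - 1) / (Y.sum * (Y.map (·⁻¹)).sum))) := by
  obtain ⟨Z, rfl⟩ := Multiset.exists_cons_of_mem hy
  have hy0 := hY y hy
  have hZ : ∀ z ∈ Z, 0 < z := fun z hz => hY z (Multiset.mem_cons_of_mem hz)
  have hσ : 0 ≤ Z.sum := Multiset.sum_nonneg fun z hz => (hZ z hz).le
  have hτ : 0 ≤ (Z.map (·⁻¹)).sum := by
    refine Multiset.sum_nonneg fun z hz => ?_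
    obtain ⟨w, hw, rfl⟩ := Multiset.mem_map.1 hz
    exact (inv_pos.2 (hZ w hw)).le
  have hAH := card_sq_le_sum_mul_sum_inv Z hZ
  simp only [Multiset.card_cons, Multiset.sum_cons, Multiset.map_cons, Nat.cast_add,
    Nat.cast_one, add_sub_cancel_right]
  have hσ0 : Multiset.card Z = 0 → Z.sum = 0 := fun h => by
    rw [Multiset.card_eq_zero.1 h, Multiset.sum_zero]
  generalize hc : Multiset.card Z = c at *
  set σ := Z.sum
  set τ := (Z.map (·⁻¹)).sum
  have hs : 0 < y + σ := by positivity
  have ht : 0 < y⁻¹ + τ := by positivity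
  have hsqrt := Real.sqrt_nonneg (1 - 4 * (c : ℝ) / ((y + σ) * (y⁻¹ + τ)))
  rcases le_total y σ with hyσ | hyσ
  · nlinarith [mul_nonneg hs.le hsqrt]
  have hmain : (c : ℝ) * (y + σ) ≤ y * σ * (y⁻¹ + τ) := by
    have hexp : y * σ * (y⁻¹ + τ) = σ + y * (σ * τ) := by field_simp
    rw [hexp]
    have h1 : 0 ≤ ((c : ℝ) - 1) * (c * y - σ) := by
      rcases Nat.eq_zero_or_pos c with h | h
      · simp [h, hσ0 h]
      · have hc1 : (1 : ℝ) ≤ c := by exact_mod_cast h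
        exact mul_nonneg (by linarith) (by nlinarith)
    nlinarith [mul_le_mul_of_nonneg_left hAH hy0.le]
  have h2 : (2 * y - (y + σ)) / (y + σ) ≤
      Real.sqrt (1 - 4 * (c : ℝ) / ((y + σ) * (y⁻¹ + τ))) := by
    refine Real.le_sqrt_of_sq_le ?_
    rw [div_pow, div_le_iff₀ (by positivity), sub_mul, one_mul]
    have h3 : 4 * (c : ℝ) / ((y + σ) * (y⁻¹ + τ)) * (y + σ) ^ 2 ≤ 4 * (y * σ) := by
      rw [div_mul_eq_mul_div, div_le_iff₀ (by positivity)]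
      nlinarith [mul_le_mul_of_nonneg_left hmain hs.le]
    nlinarith
  rw [div_le_iff₀ hs] at h2
  nlinarith

open Polynomial in
theorem eval_pos_of_coeff_nonneg {p : ℝ[X]} (hp : ∀ j, 0 ≤ p.coeff j) (h0 : 0 < p.coeff 0)
    {x : ℝ} (hx : 0 ≤ x) : 0 < p.eval x := by
  rw [eval_eq_sum_range, Finset.sum_range_succ']
  have : 0 ≤ ∑ i ∈ Finset.range p.natDegree, p.coeff (i + 1) * x ^ (i + 1) :=
    Finset.sum_nonneg fun i _ => mul_nonneg (hp _) (pow_nonneg hx _)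
  simpa using add_pos_of_nonneg_of_pos this h0

open Polynomial in
/-- A bound for the roots in `(-1, 0)` of a real-rooted polynomial from its logarithmic derivatives
at the end points, in terms of the transformed roots `y = -(1 + ρ) / ρ`, whose sum and sum of
reciprocals are determined by these derivatives. -/
theorem neg_div_le_of_logDeriv {q : ℝ[X]} (hq : q.Splits)
    (hroots : ∀ ρ, q.IsRoot ρ → -1 < ρ ∧ ρ < 0) (hq0 : q ≠ 0) {s t : ℝ}
    (hs : (derivative q).eval 0 = (q.natDegree + s) * q.eval 0)
    (ht : (derivative q).eval (-1) = -(q.natDegree + t) * q.eval (-1)) {ρ : ℝ}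
    (hρ : q.IsRoot ρ) :
    -(1 + ρ) / ρ ≤ s * (1 / 2 + 1 / 2 * Real.sqrt (1 - 4 * ((q.natDegree : ℝ) - 1) / (s * t))) := by
  have h0 : q.eval 0 ≠ 0 := fun h => lt_irrefl _ (hroots 0 h).2
  have h1 : q.eval (-1) ≠ 0 := fun h => lt_irrefl _ (hroots (-1) h).1
  have hmem : ∀ σ ∈ q.roots, -1 < σ ∧ σ < 0 := fun σ hσ => hroots σ (isRoot_of_mem_roots hσ)
  have hcard := splits_iff_card_roots.1 hq
  have hsum : (q.roots.map fun σ => -(1 + σ) / σ).sum = s := by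
    have h := hq.eval_derivative_div_eval_of_ne_zero h0
    rw [hs, mul_div_cancel_right₀ _ h0] at h
    have h2 : (q.roots.map fun σ => -(1 + σ) / σ) =
        q.roots.map fun σ => 1 / (0 - σ) - 1 := by
      refine Multiset.map_congr rfl fun σ hσ => ?_
      have := (hmem σ hσ).2.ne
      rw [zero_sub]
      field_simp
      ring
    rw [h2, Multiset.sum_map_sub, ← h]
    simp [hcard]
  have hinv : ((q.roots.map fun σ => -(1 + σ) / σ).map (·⁻¹)).sum = t := by
    have h := hq.eval_derivative_div_eval_of_ne_zero h1
    rw [ht, mul_div_cancel_right₀ _ h1] at h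
    have h2 : ((q.roots.map fun σ => -(1 + σ) / σ).map (·⁻¹)) =
        q.roots.map fun σ => -(1 / (-1 - σ)) - 1 := by
      rw [Multiset.map_map]
      refine Multiset.map_congr rfl fun σ hσ => ?_
      have h3 := (hmem σ hσ).2.ne
      have h4 : 1 + σ ≠ 0 := by linarith [(hmem σ hσ).1]
      have h5 : -1 - σ ≠ 0 := by linarith [(hmem σ hσ).1]
      simp only [Function.comp]
      field_simp
      ring
    rw [h2, Multiset.sum_map_sub, Multiset.sum_map_neg, ← h]
    simp [hcard]
  have hpos : ∀ y ∈ q.roots.map fun σ => -(1 + σ) / σ, 0 < y := by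
    intro y hy
    obtain ⟨σ, hσ, rfl⟩ := Multiset.mem_map.1 hy
    exact div_pos_of_neg_of_neg (by linarith [(hmem σ hσ).1]) (hmem σ hσ).2
  have h := le_of_sum_of_sum_inv hpos
    (Multiset.mem_map_of_mem _ ((mem_roots hq0).2 hρ))
  rwa [hsum, hinv, Multiset.card_map, hcard] at h

open Polynomial in
/-- A bound for the largest root of a real-rooted polynomial `p` whose reflection `p (-1 - X)` is, up
to sign, a polynomial `T`, where both `p` and `T` have nonnegative coefficients; this forces the
roots of `p` into `[-1, 0)`. The bound depends only on the two lowest nonzero coefficients of `p`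
and of `T`; `b` is the multiplicity of `-1` as a root of `p`. -/
theorem eval_pos_of_reflection {p T : ℝ[X]} {ε : ℝ} {b d : ℕ} {s t : ℝ}
    (hp : p.Splits) (hdeg : p.natDegree = d + b) (hpT : p.comp (-1 - X) = C ε * T)
    (hpn : ∀ j, 0 ≤ p.coeff j) (hTn : ∀ j, 0 ≤ T.coeff j)
    (hp0 : 0 < p.coeff 0) (hT0 : ∀ j < b, T.coeff j = 0) (hTb : 0 < T.coeff b)
    (hp1 : p.coeff 1 = (d + b + s) * p.coeff 0)
    (hT1 : T.coeff (b + 1) = (d + t) * T.coeff b) (hs : 0 ≤ s) {x : ℝ}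
    (hx : -(1 / (1 + s * (1 / 2 + 1 / 2 * Real.sqrt (1 - 4 * ((d : ℝ) - 1) / (s * t))))) < x) :
    0 < p.eval x := by
  have hpne : p ≠ 0 := by rintro rfl; simp at hp0
  obtain ⟨V, rfl⟩ := X_pow_dvd_iff.2 hT0
  have hVc : ∀ j, V.coeff j = (X ^ b * V).coeff (j + b) := fun j => (coeff_X_pow_mul V b j).symm
  have hV0 : 0 < V.coeff 0 := by rw [hVc, zero_add]; exact hTb
  have hV1 : V.coeff 1 = (d + t) * V.coeff 0 := by rw [hVc, hVc, add_comm 1, zero_add, hT1]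
  have hVn : ∀ j, 0 ≤ V.coeff j := fun j => by rw [hVc]; exact hTn _
  set q := V.comp (-1 - X) with hq
  obtain ⟨δ, hpq⟩ : ∃ δ : ℝ, p = C δ * ((X + 1) ^ b * q) := by
    refine ⟨ε * (-1) ^ b, ?_⟩
    have h := congrArg (fun f => f.comp (-1 - X : ℝ[X])) hpT
    simp only [comp_assoc, sub_comp, X_comp, neg_comp, one_comp, mul_comp, C_comp, X_pow_comp] at h
    rw [show (-1 - (-1 - X) : ℝ[X]) = X by ring, comp_X] at h
    rw [h, hq, show (-1 - X : ℝ[X]) = -1 * (X + 1) by ring, mul_pow]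
    simp only [C_mul, C_pow, C_neg, C_1]
    ring
  have hδ : δ ≠ 0 := by rintro rfl; simp [hpq] at hpne
  have hqne : q ≠ 0 := by intro h; simp [hpq, h] at hpne
  have hX1 : (X + 1 : ℝ[X]).natDegree = 1 := natDegree_X_add_C 1
  have hX1' : (X + 1 : ℝ[X]) ≠ 0 := X_add_C_ne_zero 1
  have hqdeg : q.natDegree = d := by
    rw [hpq, natDegree_C_mul hδ, natDegree_mul (pow_ne_zero _ hX1') hqne, natDegree_pow, hX1]
      at hdeg
    omega
  have hqs : q.Splits := hp.of_dvd hpne ⟨C δ * (X + 1) ^ b, by rw [hpq]; ring⟩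
  have hproots : ∀ ρ, p.IsRoot ρ → ρ < 0 := fun ρ hρ => by
    by_contra! h
    exact (eval_pos_of_coeff_nonneg hpn hp0 h).ne' hρ
  have hqroots : ∀ ρ, q.IsRoot ρ → -1 < ρ ∧ ρ < 0 := by
    refine fun ρ hρ => ⟨?_, hproots ρ ?_⟩
    · by_contra! h
      have h2 : V.eval (-1 - ρ) = 0 := by simpa [hq, eval_comp] using hρ
      exact (eval_pos_of_coeff_nonneg hVn hV0 (by linarith)).ne' h2
    · rw [IsRoot.def] at hρ ⊢
      rw [hpq]
      simp [hρ]
  have hs' : (derivative q).eval 0 = (q.natDegree + s) * q.eval 0 := by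
    have hc0 : p.coeff 0 = δ * q.eval 0 := by
      rw [coeff_zero_eq_eval_zero, hpq]; simp
    have hc1 : p.coeff 1 = δ * (b * q.eval 0 + (derivative q).eval 0) := by
      have h : p.coeff 1 = (derivative p).eval 0 := by
        rw [← coeff_zero_eq_eval_zero, coeff_derivative]; simp
      rw [h, hpq, derivative_C_mul, derivative_mul, derivative_pow]
      simp
    rw [hc0, hc1] at hp1
    have := mul_left_cancel₀ hδ (hp1.trans (by ring :
      _ = δ * ((d + b + s) * q.eval 0)))
    rw [hqdeg]
    linarith
  have ht' : (derivative q).eval (-1) = -(q.natDegree + t) * q.eval (-1) := by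
    have hv0 : q.eval (-1) = V.coeff 0 := by
      rw [hq, eval_comp, coeff_zero_eq_eval_zero]; simp
    have hv1 : (derivative q).eval (-1) = -V.coeff 1 := by
      have h : V.coeff 1 = (derivative V).eval 0 := by
        rw [← coeff_zero_eq_eval_zero, coeff_derivative]; simp
      rw [hq, derivative_comp, h]
      simp [eval_comp]
    rw [hv0, hv1, hV1, hqdeg]
    ring
  set B := s * (1 / 2 + 1 / 2 * Real.sqrt (1 - 4 * ((d : ℝ) - 1) / (s * t))) with hB
  have hB0 : 0 ≤ B := mul_nonneg hs (by positivity)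
  refine zero_lt_eval_of_roots_lt_of_leadingCoeff_nonneg (fun ρ hρ => lt_of_le_of_lt ?_ hx) (hpn _)
  have hρ0 := hproots ρ hρ
  rw [le_neg, div_le_iff₀ (by linarith)]
  by_cases hρ1 : ρ = -1
  · rw [hρ1]; linarith
  have hqρ : q.IsRoot ρ := by
    rw [IsRoot.def, hpq] at hρ
    simp only [eval_mul, eval_C, eval_pow, eval_add, eval_X, eval_one, mul_eq_zero, hδ,
      false_or] at hρ
    exact hρ.resolve_left (pow_ne_zero _ fun h => hρ1 (by linarith))
  have h := neg_div_le_of_logDeriv hqs hqroots hqne hs' ht' hqρ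
  rw [hqdeg, ← hB, div_le_iff_of_neg hρ0] at h
  linarith

/-! ### The derivatives of `X ^ a * (X + 1) ^ n` -/

open Polynomial in
theorem coeff_iterate_derivative_X_pow_mul (N a n j : ℕ) :
    (derivative^[N] (X ^ a * (X + 1) ^ n : ℝ[X])).coeff j =
      if a ≤ j + N then ((j + N).descFactorial N : ℝ) * (n.choose (j + N - a) : ℝ) else 0 := by
  rw [coeff_iterate_derivative, coeff_X_pow_mul', coeff_X_add_one_pow, nsmul_eq_mul]
  split_ifs <;> simp

open Polynomial in
theorem iterate_derivative_comp_neg_one_sub_X (N : ℕ) (p : ℝ[X]) :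
    (derivative^[N] p).comp (-1 - X) = (-1) ^ N * derivative^[N] (p.comp (-1 - X)) := by
  induction N with
  | zero => simp
  | succ N ih =>
    have h : derivative ((derivative^[N] p).comp (-1 - X)) =
        -(derivative (derivative^[N] p)).comp (-1 - X) := by
      rw [derivative_comp]; simp
    have h2 : derivative ((-1 : ℝ[X]) ^ N * derivative^[N] (p.comp (-1 - X))) =
        (-1) ^ N * derivative (derivative^[N] (p.comp (-1 - X))) := by
      rw [← C_1, ← C_neg, ← C_pow, derivative_C_mul]
    rw [Function.iterate_succ_apply', Function.iterate_succ_apply', eq_neg_of_add_eq_zero_right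
      (a := derivative ((derivative^[N] p).comp (-1 - X)))
      (b := (derivative (derivative^[N] p)).comp (-1 - X)) (by rw [h]; ring), ih, h2, pow_succ]
    ring

open Polynomial in
theorem coeff_one_iterate_derivative_X_pow_mul {N a n : ℕ} (ha : a ≤ N) :
    (derivative^[N] (X ^ a * (X + 1) ^ n : ℝ[X])).coeff 1 * (N - a + 1) =
      (N + 1) * (n - (N - a : ℕ) : ℕ) *
        (derivative^[N] (X ^ a * (X + 1) ^ n : ℝ[X])).coeff 0 := by
  rw [coeff_iterate_derivative_X_pow_mul, coeff_iterate_derivative_X_pow_mul,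
    if_pos (by omega), if_pos (by omega)]
  have h1 : (1 + N).descFactorial N = (N + 1) * (0 + N).descFactorial N := by
    have := Nat.succ_descFactorial N N
    rw [zero_add, add_comm 1, ← this]
    simp
  have h2 := Nat.choose_succ_right_eq n (N - a)
  rw [show 1 + N - a = N - a + 1 by omega, h1, zero_add]
  have h2' : (n.choose (N - a + 1) : ℝ) * ((N : ℝ) - a + 1) =
      n.choose (N - a) * (n - (N - a : ℕ) : ℕ) := by
    rw [← Nat.cast_sub ha]
    exact_mod_cast h2
  push_cast at h2' ⊢
  linear_combination ((N : ℝ) + 1) * (N.descFactorial N : ℝ) * h2'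

open Polynomial in
theorem natDegree_iterate_derivative_X_pow_mul {N a n k : ℕ} (h : a + n = k + N) :
    (derivative^[N] (X ^ a * (X + 1) ^ n : ℝ[X])).natDegree = k := by
  have hw : (X ^ a * (X + 1) ^ n : ℝ[X]).natDegree = a + n := by
    have h1 : (X + 1 : ℝ[X]) ≠ 0 := X_add_C_ne_zero 1
    rw [natDegree_mul (pow_ne_zero _ X_ne_zero) (pow_ne_zero _ h1), natDegree_X_pow,
      natDegree_pow, show (X + 1 : ℝ[X]).natDegree = 1 from natDegree_X_add_C 1, mul_one]
  refine le_antisymm ?_ (le_natDegree_of_ne_zero ?_)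
  · refine (natDegree_iterate_derivative _ _).trans ?_
    omega
  · rw [coeff_iterate_derivative_X_pow_mul, if_pos (by omega), show k + N - a = n by omega]
    have : 0 < (k + N).descFactorial N := Nat.descFactorial_pos.2 (by omega)
    simp [this.ne']

open Polynomial in
theorem splits_iterate_derivative_X_pow_mul (N a n : ℕ) :
    (derivative^[N] (X ^ a * (X + 1) ^ n : ℝ[X])).Splits :=
  splits_iterate_derivative ((Splits.X_pow a).mul ((Splits.X_add_C 1).pow n)) N

open Polynomial in
theorem iterate_derivative_X_pow_mul_comp (N a n : ℕ) :
    (derivative^[N] (X ^ a * (X + 1) ^ n : ℝ[X])).comp (-1 - X) =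
      C ((-1) ^ (N + a + n)) * derivative^[N] (X ^ n * (X + 1) ^ a : ℝ[X]) := by
  have h : (X ^ a * (X + 1) ^ n : ℝ[X]).comp (-1 - X) =
      C ((-1) ^ (a + n)) * (X ^ n * (X + 1) ^ a : ℝ[X]) := by
    simp only [mul_comp, pow_comp, add_comp, X_comp, one_comp, C_pow, C_neg, C_1]
    rw [show (-1 - X + 1 : ℝ[X]) = -1 * X by ring, show (-1 - X : ℝ[X]) = -1 * (X + 1) by ring,
      mul_pow, mul_pow]
    ring
  rw [iterate_derivative_comp_neg_one_sub_X, h, iterate_derivative_C_mul]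
  simp only [C_pow, C_neg, C_1]
  ring

theorem coeff_iterate_derivative_X_pow_mul_nonneg (N a n j : ℕ) :
    0 ≤ (Polynomial.derivative^[N]
      (Polynomial.X ^ a * (Polynomial.X + 1) ^ n : Polynomial ℝ)).coeff j := by
  rw [coeff_iterate_derivative_X_pow_mul]
  positivity

open Polynomial in
/-- The bound for the largest root of the `(m - k)`-th derivative of `X ^ (m - n) (X + 1) ^ n` when
`n + k ≤ m`, in which case `-1` is not a root. -/
theorem eval_iterate_derivative_pos_of_add_le {m n k : ℕ} (hk : 1 ≤ k) (hkn : k ≤ n)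
    (hm : n + 1 ≤ m) (hnk : n + k ≤ m) {x : ℝ}
    (hx : -(((n : ℝ) - k + 1) / ((1 / 2 + 1 / 2 * Real.sqrt (1 - hOne m n k)) *
      (k * (m - n)) + (n - k + 1))) < x) :
    0 < (derivative^[m - k] (X ^ (m - n) * (X + 1) ^ n : ℝ[X])).eval x := by
  obtain ⟨a, rfl⟩ := Nat.exists_eq_add_of_le (show n ≤ m by omega)
  obtain ⟨N, hN⟩ := Nat.exists_eq_add_of_le (show k ≤ n + a by omega)
  rw [hN, Nat.add_sub_cancel_left, ← hN, Nat.add_sub_cancel_left]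
  have hNr : (n : ℝ) + a = k + N := by exact_mod_cast hN
  have hk0 : (1 : ℝ) ≤ k := by exact_mod_cast hk
  have ha0 : (1 : ℝ) ≤ a := by exact_mod_cast (show 1 ≤ a by omega)
  have hka : (k : ℝ) ≤ a := by exact_mod_cast (show k ≤ a by omega)
  have hkn' : (k : ℝ) ≤ n := by exact_mod_cast hkn
  have hν : (0 : ℝ) < n - k + 1 := by linarith
  have hν' : (0 : ℝ) < a - k + 1 := by linarith
  have hp1 := coeff_one_iterate_derivative_X_pow_mul (N := N) (a := a) (n := n) (by omega)
  have hT1 := coeff_one_iterate_derivative_X_pow_mul (N := N) (a := n) (n := a) (by omega)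
  rw [show n - (N - a) = k by omega] at hp1
  rw [show a - (N - n) = k by omega] at hT1
  refine eval_pos_of_reflection (d := k) (b := 0) (s := k * a / (n - k + 1))
    (t := k * n / (a - k + 1)) (splits_iterate_derivative_X_pow_mul N a n)
    (natDegree_iterate_derivative_X_pow_mul (by omega)) (iterate_derivative_X_pow_mul_comp N a n)
    (coeff_iterate_derivative_X_pow_mul_nonneg N a n)
    (coeff_iterate_derivative_X_pow_mul_nonneg N n a) ?_ (by simp) ?_ ?_ ?_ (by positivity) ?_
  · rw [coeff_iterate_derivative_X_pow_mul, if_pos (by omega)]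
    exact mul_pos (by exact_mod_cast Nat.descFactorial_pos.2 (by omega))
      (by exact_mod_cast Nat.choose_pos (by omega))
  · rw [coeff_iterate_derivative_X_pow_mul, if_pos (by omega)]
    exact mul_pos (by exact_mod_cast Nat.descFactorial_pos.2 (by omega))
      (by exact_mod_cast Nat.choose_pos (by omega))
  · rw [show (N : ℝ) = n + a - k by linarith] at hp1
    rw [Nat.cast_zero]
    field_simp
    linear_combination hp1
  · rw [show (N : ℝ) = n + a - k by linarith] at hT1
    rw [zero_add]
    field_simp
    linear_combination hT1
  · have hh : 4 * ((k : ℝ) - 1) / (k * a / (n - k + 1) * (k * n / (a - k + 1))) =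
        hOne (n + a : ℕ) n k := by
      unfold hOne
      push_cast
      have : (0 : ℝ) < n := by linarith
      rw [add_sub_cancel_left]
      field_simp
      ring
    rw [hh]
    refine lt_of_le_of_lt (le_of_eq ?_) hx
    push_cast
    rw [add_sub_cancel_left]
    have hα : 0 ≤ 1 / 2 + 1 / 2 * Real.sqrt (1 - hOne (n + a) n k) := by positivity
    field_simp
    ring

open Polynomial in
/-- The bound for the largest root of the `(m - k)`-th derivative of `X ^ (m - n) (X + 1) ^ n` when
`m ≤ n + k`, in which case `-1` is a root of multiplicity `n + k - m`. -/
theorem eval_iterate_derivative_pos_of_le_add {m n k : ℕ} (hk : 1 ≤ k) (hkn : k ≤ n)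
    (hm : n + 1 ≤ m) (hnk : m ≤ n + k) {x : ℝ}
    (hx : -(((n : ℝ) - k + 1) / ((1 / 2 + 1 / 2 * Real.sqrt (1 - hTwo m n k)) *
      (k * (m - n)) + (n - k + 1))) < x) :
    0 < (derivative^[m - k] (X ^ (m - n) * (X + 1) ^ n : ℝ[X])).eval x := by
  obtain ⟨a, rfl⟩ := Nat.exists_eq_add_of_le (show n ≤ m by omega)
  obtain ⟨N, hN⟩ := Nat.exists_eq_add_of_le (show k ≤ n + a by omega)
  obtain ⟨b, hb⟩ := Nat.exists_eq_add_of_le (show a ≤ k by omega)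
  rw [hN, Nat.add_sub_cancel_left, ← hN, Nat.add_sub_cancel_left]
  have hNr : (n : ℝ) + a = k + N := by exact_mod_cast hN
  have hbr : (k : ℝ) = a + b := by exact_mod_cast hb
  have hk0 : (1 : ℝ) ≤ k := by exact_mod_cast hk
  have ha0 : (1 : ℝ) ≤ a := by exact_mod_cast (show 1 ≤ a by omega)
  have hkn' : (k : ℝ) ≤ n := by exact_mod_cast hkn
  have hN0 : (0 : ℝ) < N := by linarith
  have hν : (0 : ℝ) < n - k + 1 := by linarith
  have hp1 := coeff_one_iterate_derivative_X_pow_mul (N := N) (a := a) (n := n) (by omega)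
  rw [show n - (N - a) = k by omega] at hp1
  refine eval_pos_of_reflection (d := a) (b := b) (s := k * a / (n - k + 1))
    (t := a * N / (b + 1)) (splits_iterate_derivative_X_pow_mul N a n)
    (natDegree_iterate_derivative_X_pow_mul (by omega)) (iterate_derivative_X_pow_mul_comp N a n)
    (coeff_iterate_derivative_X_pow_mul_nonneg N a n)
    (coeff_iterate_derivative_X_pow_mul_nonneg N n a) ?_ ?_ ?_ ?_ ?_ (by positivity) ?_
  · rw [coeff_iterate_derivative_X_pow_mul, if_pos (by omega)]
    exact mul_pos (by exact_mod_cast Nat.descFactorial_pos.2 (by omega))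
      (by exact_mod_cast Nat.choose_pos (by omega))
  · intro j hj
    rw [coeff_iterate_derivative_X_pow_mul, if_neg (by omega)]
  · rw [coeff_iterate_derivative_X_pow_mul, if_pos (by omega)]
    exact mul_pos (by exact_mod_cast Nat.descFactorial_pos.2 (by omega))
      (by exact_mod_cast Nat.choose_pos (by omega))
  · rw [show (N : ℝ) = n + a - k by linarith] at hp1
    rw [← hbr]
    field_simp
    linear_combination hp1
  · rw [coeff_iterate_derivative_X_pow_mul, coeff_iterate_derivative_X_pow_mul,
      if_pos (by omega), if_pos (by omega), show b + 1 + N = n + 1 by omega,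
      show b + N = n by omega, Nat.add_sub_cancel_left, Nat.sub_self, Nat.choose_one_right,
      Nat.choose_zero_right]
    have h := Nat.succ_descFactorial n N
    rw [show n + 1 - N = b + 1 by omega] at h
    have h' : ((b : ℝ) + 1) * (n + 1).descFactorial N = (n + 1) * n.descFactorial N := by
      exact_mod_cast h
    rw [show (n : ℝ) = b + N by linarith] at h'
    field_simp
    push_cast
    linear_combination h'
  · have hh : 4 * ((a : ℝ) - 1) / (k * a / (n - k + 1) * (a * N / (b + 1))) =
        hTwo (n + a : ℕ) n k := by
      unfold hTwo
      push_cast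
      have hb1 : (0 : ℝ) < k - a + 1 := by linarith [(Nat.cast_nonneg b : (0 : ℝ) ≤ b)]
      have hN1 : (0 : ℝ) < n + a - k := by linarith
      rw [add_sub_cancel_left, show (b : ℝ) = k - a by linarith,
        show (N : ℝ) = n + a - k by linarith]
      field_simp
      ring
    rw [hh]
    refine lt_of_le_of_lt (le_of_eq ?_) hx
    push_cast
    rw [add_sub_cancel_left]
    have hα : 0 ≤ 1 / 2 + 1 / 2 * Real.sqrt (1 - hTwo (n + a) n k) := by positivity
    field_simp
    ring

/-! ### Principal submatrices of projections -/

open Polynomial Matrix in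
/-- If the characteristic polynomial of a symmetric matrix is positive to the right of `r`, then `r`
bounds its quadratic form. -/
theorem dotProduct_mulVec_le_of_charpoly_pos {ι : Type*} [Fintype ι] [DecidableEq ι]
    {A : Matrix ι ι ℝ} (hA : A.IsHermitian) {r : ℝ} (h : ∀ x, r < x → 0 < A.charpoly.eval x)
    (v : ι → ℝ) : v ⬝ᵥ A *ᵥ v ≤ r * (v ⬝ᵥ v) := by
  have hB : (r • (1 : Matrix ι ι ℝ) - A).IsHermitian := by
    refine IsHermitian.sub ?_ hA
    rw [IsHermitian, conjTranspose_smul, conjTranspose_one, star_trivial]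
  have hpsd : (r • (1 : Matrix ι ι ℝ) - A).PosSemidef := by
    refine hB.posSemidef_iff_eigenvalues_nonneg.2 fun j => ?_
    by_contra! hneg
    have hneg : hB.eigenvalues j < 0 := hneg
    refine (h (r - hB.eigenvalues j) (by linarith)).ne' ?_
    rw [eval_charpoly]
    refine exists_mulVec_eq_zero_iff.1 ⟨hB.eigenvectorBasis j, ?_, ?_⟩
    · intro h0
      refine hB.eigenvectorBasis.toBasis.ne_zero j ?_
      rw [OrthonormalBasis.coe_toBasis]
      exact WithLp.ofLp_injective 2 h0
    · have h1 := hB.mulVec_eigenvectorBasis j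
      rw [scalar_apply, ← smul_one_eq_diagonal]
      rw [sub_mulVec, smul_mulVec, one_mulVec] at h1 ⊢
      rw [sub_smul, ← h1]
      abel
  have h2 := hpsd.dotProduct_mulVec_nonneg v
  rw [star_trivial, sub_mulVec, smul_mulVec, one_mulVec, dotProduct_sub, dotProduct_smul,
    smul_eq_mul] at h2
  linarith

open Polynomial Matrix in
/-- The characteristic polynomial of the negative of an orthogonal projection. -/
theorem charpoly_neg_projection {m n : ℕ} {P : Matrix (Fin m) (Fin m) ℝ} (hP : P.IsHermitian)
    (hPP : P * P = P) (htr : P.trace = n) :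
    (-P).charpoly = X ^ (m - n) * (X + 1) ^ n := by
  have hA : (-P).IsHermitian := hP.neg
  have heig : ∀ j, hA.eigenvalues j = 0 ∨ hA.eigenvalues j = -1 := by
    intro j
    have h1 := hA.mulVec_eigenvectorBasis j
    have h2 : (-P) *ᵥ ((-P) *ᵥ ⇑(hA.eigenvectorBasis j)) =
        -((-P) *ᵥ ⇑(hA.eigenvectorBasis j)) := by
      rw [mulVec_mulVec, neg_mul_neg, hPP, neg_mulVec, neg_neg]
    rw [h1, mulVec_smul, h1, smul_smul, ← neg_smul] at h2
    have h0 : (hA.eigenvectorBasis j).ofLp ≠ 0 := by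
      intro h0
      refine hA.eigenvectorBasis.toBasis.ne_zero j ?_
      rw [OrthonormalBasis.coe_toBasis]
      exact WithLp.ofLp_injective 2 h0
    have h3 := smul_left_injective ℝ h0 h2
    have h4 : hA.eigenvalues j * (hA.eigenvalues j + 1) = 0 := by linarith
    rcases mul_eq_zero.1 h4 with h | h
    · exact Or.inl h
    · exact Or.inr (by linarith)
  set F := Finset.univ.filter fun j => hA.eigenvalues j = 0 with hF
  set E := Finset.univ.filter fun j => ¬ hA.eigenvalues j = 0 with hE
  have hcard : F.card + E.card = m := by
    rw [hF, hE, Finset.card_filter_add_card_filter_not, Finset.card_univ, Fintype.card_fin]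
  have hEn : E.card = n := by
    have h := hA.trace_eq_sum_eigenvalues
    rw [trace_neg, htr, ← Finset.sum_filter_add_sum_filter_not _ fun j => hA.eigenvalues j = 0,
      Finset.sum_congr rfl (g := fun _ => (0 : ℝ)) (by simp),
      Finset.sum_congr (s₁ := Finset.univ.filter fun j => ¬ hA.eigenvalues j = 0) rfl
        (g := fun _ => (-1 : ℝ)) ?_] at h
    · simp only [Finset.sum_const, smul_zero, zero_add, nsmul_eq_mul, mul_neg, mul_one,
        neg_inj] at h
      exact_mod_cast h.symm
    · intro j hj
      simpa using (heig j).resolve_left (Finset.mem_filter.1 hj).2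
  rw [hA.charpoly_eq, ← Finset.prod_filter_mul_prod_filter_not _ fun j => hA.eigenvalues j = 0,
    Finset.prod_congr (s₁ := Finset.univ.filter fun j => hA.eigenvalues j = 0) rfl
      (g := fun _ => (X : ℝ[X])) ?_,
    Finset.prod_congr (s₁ := Finset.univ.filter fun j => ¬ hA.eigenvalues j = 0) rfl
      (g := fun _ => (X + 1 : ℝ[X])) ?_, Finset.prod_const, Finset.prod_const, ← hF, ← hE, hEn]
  · congr 2
    omega
  · intro j hj
    have := (heig j).resolve_left (Finset.mem_filter.1 hj).2
    simp [this]
  · intro j hj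
    have := (Finset.mem_filter.1 hj).2
    simp [this]

open Polynomial Matrix in
/-- An orthogonal projection of rank `n` has a `k × k` principal submatrix whose smallest eigenvalue
is at least the smallest zero of `derivative^[m - k] (X ^ (m - n) (X - 1) ^ n)`, formulated here
after the reflection `x ↦ -x`. -/
theorem exists_finset_projection {m n k : ℕ} (hkm : k ≤ m) {P : Matrix (Fin m) (Fin m) ℝ}
    (hP : P.IsHermitian) (hPP : P * P = P) (htr : P.trace = n) {ρ : ℝ}
    (hρ : ∀ x, -ρ < x → 0 < (derivative^[m - k] (X ^ (m - n) * (X + 1) ^ n : ℝ[X])).eval x) :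
    ∃ S : Finset (Fin m), S.card = k ∧ ∀ v : Fin m → ℝ, (∀ i ∉ S, v i = 0) →
      ρ * (v ⬝ᵥ v) ≤ v ⬝ᵥ P *ᵥ v := by
  rw [← charpoly_neg_projection hP hPP htr] at hρ
  obtain ⟨N, rfl⟩ := Nat.exists_eq_add_of_le hkm
  rw [Nat.add_sub_cancel_left] at hρ
  obtain ⟨e, he⟩ := exists_submatrix_charpoly_pos N hP.neg hρ
  refine ⟨Finset.univ.map e, by simp, fun v hv => ?_⟩
  have hsum : ∀ f : Fin (k + N) → ℝ, (∀ i, v i = 0 → f i = 0) → ∑ i, f i = ∑ j, f (e j) := by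
    intro f hf
    rw [← Finset.sum_map Finset.univ e f]
    exact (Finset.sum_subset (Finset.subset_univ _) fun i _ hi => hf i (hv i hi)).symm
  have h := dotProduct_mulVec_le_of_charpoly_pos (hP.neg.submatrix e) he (v ∘ e)
  have h1 : v ⬝ᵥ v = (v ∘ e) ⬝ᵥ (v ∘ e) := hsum _ fun i hi => by rw [hi, mul_zero]
  have h2 : v ⬝ᵥ P *ᵥ v = -((v ∘ e) ⬝ᵥ ((-P).submatrix e e) *ᵥ (v ∘ e)) := by
    rw [dotProduct, hsum _ fun i hi => by rw [hi, zero_mul],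
      show (-P).submatrix e e = -P.submatrix e e from rfl, neg_mulVec,
      dotProduct_neg, neg_neg]
    refine Finset.sum_congr rfl fun j _ => ?_
    rw [mulVec, dotProduct, hsum _ fun i hi => by rw [hi, mul_zero]]
    rfl
  rw [h1, h2]
  linarith

/-! ### Smallest singular values and the projection onto the row space -/

open Matrix in
theorem norm_toLp_sq {ι : Type*} [Fintype ι] (v : ι → ℝ) :
    ‖(WithLp.toLp 2 v : EuclideanSpace ℝ ι)‖ ^ 2 = v ⬝ᵥ v := by
  rw [EuclideanSpace.real_norm_sq_eq]
  exact Finset.sum_congr rfl fun i _ => sq _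

open Matrix in
theorem zero_le_dotProduct_self {ι : Type*} [Fintype ι] (v : ι → ℝ) : 0 ≤ v ⬝ᵥ v :=
  Finset.sum_nonneg fun i _ => mul_self_nonneg (v i)

theorem minStretch_nonneg {ι κ : Type*} [Fintype ι] [Fintype κ] (M : Matrix ι κ ℝ) :
    0 ≤ minStretch M := Real.iInf_nonneg fun _ => norm_nonneg _

open Matrix in
theorem minStretch_sq_mul_le {ι κ : Type*} [Fintype ι] [Fintype κ] (M : Matrix ι κ ℝ)
    (x : κ → ℝ) : minStretch M ^ 2 * (x ⬝ᵥ x) ≤ (M *ᵥ x) ⬝ᵥ (M *ᵥ x) := by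
  by_cases hx : x = 0
  · simp [hx]
  set y : EuclideanSpace ℝ κ := WithLp.toLp 2 x with hy
  have hy0 : 0 < ‖y‖ := norm_pos_iff.2 fun h => hx (WithLp.toLp_injective 2 h)
  have hmem : ‖y‖⁻¹ • y ∈ Metric.sphere (0 : EuclideanSpace ℝ κ) 1 := by
    rw [mem_sphere_zero_iff_norm, norm_smul, norm_inv, norm_norm, inv_mul_cancel₀ hy0.ne']
  have h : minStretch M ≤ ‖y‖⁻¹ * ‖(WithLp.toLp 2 (M *ᵥ x) : EuclideanSpace ℝ ι)‖ := by
    have h1 := ciInf_le (f := fun z : Metric.sphere (0 : EuclideanSpace ℝ κ) 1 =>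
      ‖(WithLp.toLp 2 (M.mulVec (z : EuclideanSpace ℝ κ).ofLp) : EuclideanSpace ℝ ι)‖)
      ⟨0, by rintro _ ⟨z, rfl⟩; exact norm_nonneg _⟩ ⟨_, hmem⟩
    refine h1.trans (le_of_eq ?_)
    simp only [hy, WithLp.ofLp_smul, mulVec_smul, WithLp.toLp_smul, norm_smul, norm_inv, norm_norm]
  rw [← norm_toLp_sq, ← norm_toLp_sq, ← mul_pow]
  refine pow_le_pow_left₀ (mul_nonneg (minStretch_nonneg M) (norm_nonneg _)) ?_ 2
  rw [← hy]
  calc minStretch M * ‖y‖ ≤ ‖y‖⁻¹ * ‖(WithLp.toLp 2 (M *ᵥ x) : EuclideanSpace ℝ ι)‖ * ‖y‖ :=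
        mul_le_mul_of_nonneg_right h hy0.le
    _ = _ := by field_simp

open Matrix in
theorem le_minStretch_sq {ι κ : Type*} [Fintype ι] [Fintype κ] [Nonempty κ] {M : Matrix ι κ ℝ}
    {c : ℝ} (hc : 0 ≤ c) (h : ∀ x, c * (x ⬝ᵥ x) ≤ (M *ᵥ x) ⬝ᵥ (M *ᵥ x)) :
    c ≤ minStretch M ^ 2 := by
  have hne : Nonempty (Metric.sphere (0 : EuclideanSpace ℝ κ) 1) :=
    (NormedSpace.sphere_nonempty.2 zero_le_one).to_subtype
  have h1 : Real.sqrt c ≤ minStretch M := by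
    refine le_ciInf fun x => Real.sqrt_le_iff.2 ⟨norm_nonneg _, ?_⟩
    rw [norm_toLp_sq]
    refine le_trans (le_of_eq ?_) (h _)
    rw [← norm_toLp_sq, WithLp.toLp_ofLp, mem_sphere_zero_iff_norm.1 x.2]
    ring
  rw [← Real.sq_sqrt hc]
  exact pow_le_pow_left₀ (Real.sqrt_nonneg _) h1 2

open Matrix in
theorem dotProduct_sq_le {ι : Type*} [Fintype ι] (v w : ι → ℝ) :
    (v ⬝ᵥ w) ^ 2 ≤ (v ⬝ᵥ v) * (w ⬝ᵥ w) := by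
  have := Finset.sum_mul_sq_le_sq_mul_sq Finset.univ v w
  simpa only [dotProduct, ← sq] using this

open Matrix in
/-- The orthogonal projection onto the row space of a matrix of full row rank. -/
noncomputable def rowProjection {n m : ℕ} (A : Matrix (Fin n) (Fin m) ℝ) : Matrix (Fin m) (Fin m) ℝ :=
  Aᵀ * (A * Aᵀ)⁻¹ * A

open Matrix in
theorem isUnit_det_mul_transpose {n m : ℕ} {A : Matrix (Fin n) (Fin m) ℝ} (hA : A.rank = n) :
    IsUnit (A * Aᵀ).det := by
  rw [← isUnit_iff_isUnit_det, ← mulVec_surjective_iff_isUnit]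
  have h : Module.finrank ℝ (LinearMap.range (A * Aᵀ).mulVecLin) =
      Module.finrank ℝ (Fin n → ℝ) := by
    rw [Module.finrank_fin_fun]
    exact (rank_self_mul_transpose A).trans hA
  exact LinearMap.range_eq_top.1 (Submodule.eq_top_of_finrank_eq h)

open Matrix in
theorem rowProjection_isHermitian {n m : ℕ} (A : Matrix (Fin n) (Fin m) ℝ) :
    (rowProjection A).IsHermitian := by
  rw [IsHermitian, conjTranspose_eq_transpose_of_trivial, rowProjection, transpose_mul,
    transpose_mul, transpose_transpose, transpose_nonsing_inv, transpose_mul, transpose_transpose,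
    Matrix.mul_assoc]

open Matrix in
theorem mul_rowProjection {n m : ℕ} {A : Matrix (Fin n) (Fin m) ℝ} (hA : A.rank = n) :
    A * rowProjection A = A := by
  rw [rowProjection, ← Matrix.mul_assoc, ← Matrix.mul_assoc, mul_nonsing_inv _ (isUnit_det_mul_transpose hA),
    Matrix.one_mul]

open Matrix in
theorem rowProjection_mul_self {n m : ℕ} {A : Matrix (Fin n) (Fin m) ℝ} (hA : A.rank = n) :
    rowProjection A * rowProjection A = rowProjection A := by
  conv_lhs => rw [rowProjection, Matrix.mul_assoc, ← rowProjection, mul_rowProjection hA]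
  rw [rowProjection]

open Matrix in
theorem rowProjection_trace {n m : ℕ} {A : Matrix (Fin n) (Fin m) ℝ} (hA : A.rank = n) :
    (rowProjection A).trace = n := by
  rw [rowProjection, trace_mul_comm, ← Matrix.mul_assoc,
    mul_nonsing_inv _ (isUnit_det_mul_transpose hA), trace_one, Fintype.card_fin]

open Matrix in
/-- `‖A v‖ ≥ σ ‖P v‖`, where `P` is the orthogonal projection onto the row space of `A` and
`σ ‖w‖ ≤ ‖Aᵀ w‖` for all `w`. -/
theorem minStretch_transpose_sq_mul_projection_le {n m : ℕ} {A : Matrix (Fin n) (Fin m) ℝ}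
    (hA : A.rank = n) (v : Fin m → ℝ) :
    minStretch Aᵀ ^ 2 * (v ⬝ᵥ rowProjection A *ᵥ v) ≤ (A *ᵥ v) ⬝ᵥ (A *ᵥ v) := by
  set w := ((A * Aᵀ)⁻¹ * A) *ᵥ v with hw
  have hu : rowProjection A *ᵥ v = Aᵀ *ᵥ w := by
    rw [hw, mulVec_mulVec, rowProjection, Matrix.mul_assoc]
  have hAu : A *ᵥ (Aᵀ *ᵥ w) = A *ᵥ v := by
    rw [← hu, mulVec_mulVec, mul_rowProjection hA]
  have hvw : v ⬝ᵥ Aᵀ *ᵥ w = w ⬝ᵥ A *ᵥ v := by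
    rw [mulVec_transpose, dotProduct_comm, dotProduct_mulVec]
  have huu : (Aᵀ *ᵥ w) ⬝ᵥ (Aᵀ *ᵥ w) = w ⬝ᵥ A *ᵥ v := by
    conv_lhs => rw [mulVec_transpose A w]
    rw [← dotProduct_mulVec, ← mulVec_transpose, hAu]
  have h1 := minStretch_sq_mul_le Aᵀ w
  have h2 := dotProduct_sq_le w (A *ᵥ v)
  rw [hu, hvw]
  rw [huu] at h1
  have h3 : 0 ≤ (A *ᵥ v) ⬝ᵥ (A *ᵥ v) := zero_le_dotProduct_self _
  have h4 : 0 ≤ w ⬝ᵥ A *ᵥ v := huu ▸ zero_le_dotProduct_self _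
  rcases h4.eq_or_lt with h | h
  · rw [← h, mul_zero]; exact h3
  · refine le_of_mul_le_mul_left ?_ h
    nlinarith [mul_le_mul_of_nonneg_left h2 (sq_nonneg (minStretch Aᵀ)),
      mul_le_mul_of_nonneg_right h1 h3]

open Matrix in
/-- Columns selected by a well-conditioned principal submatrix of the projection onto the row
space. -/
theorem le_sigmaMin_columnSubmatrix_of_card_le {n m : ℕ} {A : Matrix (Fin n) (Fin m) ℝ}
    (hA : A.rank = n) {S : Finset (Fin m)} (hS : S.card ≤ n) (hS0 : S.Nonempty) {ρ : ℝ}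
    (hρ : 0 ≤ ρ) (h : ∀ v : Fin m → ℝ, (∀ i ∉ S, v i = 0) →
      ρ * (v ⬝ᵥ v) ≤ v ⬝ᵥ rowProjection A *ᵥ v) :
    ρ * minStretch Aᵀ ^ 2 ≤ sigmaMin (columnSubmatrix A S) ^ 2 := by
  have := hS0.to_subtype
  rw [sigmaMin, if_pos (by simpa using hS)]
  refine le_minStretch_sq (by positivity) fun x => ?_
  set v : Fin m → ℝ := fun i => if hi : i ∈ S then x ⟨i, hi⟩ else 0 with hv
  have hsum : ∀ f : Fin m → ℝ, (∀ i ∉ S, f i = 0) → ∑ i, f i = ∑ j : S, f j := by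
    intro f hf
    rw [← Finset.sum_subset (Finset.subset_univ S) fun i _ hi => hf i hi, Finset.sum_coe_sort S f]
  have hvS : ∀ i ∉ S, v i = 0 := fun i hi => by simp [hv, hi]
  have hvx : ∀ j : S, v j = x j := fun j => by simp [hv]
  have h1 : v ⬝ᵥ v = x ⬝ᵥ x := by
    rw [dotProduct, hsum _ fun i hi => by rw [hvS i hi, mul_zero]]
    exact Finset.sum_congr rfl fun j _ => by rw [hvx]
  have h2 : A *ᵥ v = columnSubmatrix A S *ᵥ x := by
    ext a
    rw [mulVec, dotProduct, hsum _ fun i hi => by rw [hvS i hi, mul_zero]]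
    exact Finset.sum_congr rfl fun j _ => by rw [hvx]; rfl
  rw [← h1, ← h2]
  refine le_trans ?_ (minStretch_transpose_sq_mul_projection_le hA v)
  nlinarith [mul_le_mul_of_nonneg_left (h v hvS) (sq_nonneg (minStretch Aᵀ))]

open Matrix in
/-- Columns whose complement is selected by a well-conditioned principal submatrix of the projection
onto the kernel. -/
theorem le_sigmaMin_columnSubmatrix_of_lt_card {n m : ℕ} {A : Matrix (Fin n) (Fin m) ℝ}
    (hA : A.rank = n) (hn : 1 ≤ n) {S : Finset (Fin m)} (hS : n < S.card) {ρ : ℝ}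
    (hρ : 0 ≤ ρ) (hρ1 : ρ ≤ 1) (h : ∀ v : Fin m → ℝ, (∀ i ∈ S, v i = 0) →
      ρ * (v ⬝ᵥ v) ≤ v ⬝ᵥ (1 - rowProjection A) *ᵥ v) :
    ρ * minStretch Aᵀ ^ 2 ≤ sigmaMin (columnSubmatrix A S) ^ 2 := by
  have : Nonempty (Fin n) := ⟨⟨0, hn⟩⟩
  rw [sigmaMin, if_neg (by simpa using hS)]
  refine le_minStretch_sq (by positivity) fun x => ?_
  set u := Aᵀ *ᵥ x with hu
  have hPu : rowProjection A *ᵥ u = u := by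
    have h1 := congrArg transpose (mul_rowProjection hA)
    rw [transpose_mul, ← conjTranspose_eq_transpose_of_trivial (rowProjection A),
      (rowProjection_isHermitian A).eq] at h1
    rw [hu, mulVec_mulVec, h1]
  set v : Fin m → ℝ := fun i => if i ∈ S then 0 else u i with hv
  have hvS : ∀ i ∈ S, v i = 0 := fun i hi => by simp [hv, hi]
  have hvv : v ⬝ᵥ v = u ⬝ᵥ v := by
    refine Finset.sum_congr rfl fun i _ => ?_
    by_cases hi : i ∈ S <;> simp [hv, hi]
  have hsym : ∀ a b : Fin m → ℝ, a ⬝ᵥ rowProjection A *ᵥ b = (rowProjection A *ᵥ a) ⬝ᵥ b := by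
    intro a b
    rw [dotProduct_mulVec, ← mulVec_transpose, ← conjTranspose_eq_transpose_of_trivial,
      (rowProjection_isHermitian A).eq]
  have huP : u ⬝ᵥ v = u ⬝ᵥ rowProjection A *ᵥ v := by rw [hsym, hPu]
  have hPP : (rowProjection A *ᵥ v) ⬝ᵥ (rowProjection A *ᵥ v) = v ⬝ᵥ rowProjection A *ᵥ v := by
    rw [← hsym, mulVec_mulVec, rowProjection_mul_self hA]
  have hres : (columnSubmatrix A S)ᵀ *ᵥ x ⬝ᵥ (columnSubmatrix A S)ᵀ *ᵥ x =
      u ⬝ᵥ u - v ⬝ᵥ v := by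
    have h1 : ∀ j : S, ((columnSubmatrix A S)ᵀ *ᵥ x) j = u j := fun j => rfl
    simp only [dotProduct, h1]
    rw [Finset.sum_coe_sort S fun i => u i * u i, ← Finset.sum_sub_distrib,
      ← Finset.sum_subset (Finset.subset_univ S)]
    · exact Finset.sum_congr rfl fun i hi => by simp [hv, hi]
    · intro i _ hi
      simp [hv, hi]
  have h2 := h v hvS
  rw [sub_mulVec, one_mulVec, dotProduct_sub] at h2
  have h3 := dotProduct_sq_le u (rowProjection A *ᵥ v)
  rw [hPP, ← huP, ← hvv] at h3
  have huu : 0 ≤ u ⬝ᵥ u := zero_le_dotProduct_self u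
  have hvle : v ⬝ᵥ v ≤ (1 - ρ) * (u ⬝ᵥ u) := by
    rcases (zero_le_dotProduct_self v).eq_or_lt with h4 | h4
    · rw [← h4]; exact mul_nonneg (by linarith) huu
    · refine le_of_mul_le_mul_left ?_ h4
      nlinarith [mul_le_mul_of_nonneg_left h2 huu]
  rw [hres]
  nlinarith [mul_le_mul_of_nonneg_left (minStretch_sq_mul_le Aᵀ x) hρ]

/-! ### The constant `alphaConst` and the selection of columns -/

theorem hOne_sub_sub {m n k : ℝ} (hn : n ≠ 0) (hmn : m - n ≠ 0) (hmk : m - k ≠ 0) :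
    hOne m (m - n) (m - k) = hTwo m k n := by
  unfold hOne hTwo
  rw [sub_sub_cancel, sub_sub_cancel]
  field_simp
  ring

theorem hTwo_sub_sub {m n k : ℝ} (hn : n ≠ 0) (hk : k ≠ 0) (hmk : m - k ≠ 0) :
    hTwo m (m - n) (m - k) = hOne m k n := by
  unfold hOne hTwo
  rw [sub_sub_cancel, sub_sub_cancel]
  field_simp
  ring

theorem alphaConst_nonneg (m n k : ℕ) : 0 ≤ alphaConst m n k := by
  unfold alphaConst
  split_ifs <;> positivity

open Polynomial in
/-- The root bound in terms of `alphaConst` for `k ≤ n`. -/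
theorem eval_iterate_derivative_pos_of_le {m n k : ℕ} (hk : 1 ≤ k) (hkn : k ≤ n)
    (hm : n + 1 ≤ m) {x : ℝ}
    (hx : -(((n : ℝ) - k + 1) / (alphaConst m n k * (k * (m - n)) + (n - k + 1))) < x) :
    0 < (derivative^[m - k] (X ^ (m - n) * (X + 1) ^ n : ℝ[X])).eval x := by
  unfold alphaConst at hx
  rw [if_pos hkn, if_pos hkn] at hx
  split_ifs at hx with hnk
  · exact eval_iterate_derivative_pos_of_add_le hk hkn hm hnk hx
  · exact eval_iterate_derivative_pos_of_le_add hk hkn hm (by omega) hx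

open Polynomial in
/-- The root bound for the complementary parameters `m - n` and `m - k`, in terms of the value of
`alphaConst` for `n < k`. -/
theorem eval_iterate_derivative_pos_of_lt {m n k : ℕ} (hn : 1 ≤ n) (hkn : n < k)
    (hm : k < m) {x : ℝ}
    (hx : -(((k : ℝ) - n + 1) / (alphaConst m n k * (n * (m - k)) + (k - n + 1))) < x) :
    0 < (derivative^[m - (m - k)]
      (X ^ (m - (m - n)) * (X + 1) ^ (m - n) : ℝ[X])).eval x := by
  have hn0 : (n : ℝ) ≠ 0 := by exact_mod_cast (show n ≠ 0 by omega)
  have hk0 : (k : ℝ) ≠ 0 := by exact_mod_cast (show k ≠ 0 by omega)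
  have hmn : (m : ℝ) - n ≠ 0 := sub_ne_zero.2 (by exact_mod_cast (show m ≠ n by omega))
  have hmk : (m : ℝ) - k ≠ 0 := sub_ne_zero.2 (by exact_mod_cast (show m ≠ k by omega))
  have e : ∀ α : ℝ, ((k : ℝ) - n + 1) / (α * (n * (m - k)) + (k - n + 1)) =
      (((m - n : ℕ) : ℝ) - (m - k : ℕ) + 1) /
        (α * (((m - k : ℕ) : ℝ) * (m - (m - n : ℕ))) + (((m - n : ℕ) : ℝ) - (m - k : ℕ) + 1)) := by
    intro α
    rw [Nat.cast_sub (by omega), Nat.cast_sub (by omega)]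
    congr 1 <;> ring
  rw [e] at hx
  unfold alphaConst at hx
  by_cases hnk : n + k ≤ m
  · rw [if_pos hnk, if_neg (by omega), ← hTwo_sub_sub hn0 hk0 hmk, ← Nat.cast_sub (show n ≤ m by omega),
      ← Nat.cast_sub (show k ≤ m by omega)] at hx
    exact eval_iterate_derivative_pos_of_le_add (by omega) (by omega) (by omega) (by omega) hx
  · rw [if_neg hnk, if_neg (by omega), ← hOne_sub_sub hn0 hmn hmk, ← Nat.cast_sub (show n ≤ m by omega),
      ← Nat.cast_sub (show k ≤ m by omega)] at hx
    exact eval_iterate_derivative_pos_of_add_le (by omega) (by omega) (by omega) (by omega) hx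

open Matrix in
theorem theorem1p1 (n m k : ℕ) (hm : n + 1 ≤ m) (hk : 1 ≤ k) (hkm : k ≤ m)
    (A : Matrix (Fin n) (Fin m) ℝ) (hA : A.rank = n) :
    ∃ S₀ : Finset (Fin m), S₀.card = k ∧
      sigmaMin (columnSubmatrix A S₀) ^ 2 ≥
        (|(n : ℝ) - (k : ℝ)| + 1) /
            (alphaConst m n k * (min (k : ℝ) (n : ℝ) * (m : ℝ) - (n : ℝ) * (k : ℝ)) +
              |(n : ℝ) - (k : ℝ)| + 1) *
          sigmaMin A ^ 2 := by
  have hσ : sigmaMin A = minStretch Aᵀ := by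
    rw [sigmaMin, if_neg (by simpa using hm)]
  rw [hσ]
  have hP := rowProjection_isHermitian A
  have hPP := rowProjection_mul_self hA
  have htr := rowProjection_trace hA
  have hα := alphaConst_nonneg m n k
  have hmr : (n : ℝ) + 1 ≤ m := by exact_mod_cast hm
  have hkr : (1 : ℝ) ≤ k := by exact_mod_cast hk
  have hkmr : (k : ℝ) ≤ m := by exact_mod_cast hkm
  rcases le_or_gt k n with hkn | hkn
  · have hknr : (k : ℝ) ≤ n := by exact_mod_cast hkn
    obtain ⟨S, hS, h⟩ := exists_finset_projection hkm hP hPP htr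
      fun x hx => eval_iterate_derivative_pos_of_le hk hkn hm hx
    refine ⟨S, hS, ?_⟩
    rw [abs_of_nonneg (by linarith), min_eq_left hknr, add_assoc,
      show (k : ℝ) * m - n * k = k * (m - n) by ring]
    refine le_sigmaMin_columnSubmatrix_of_card_le hA (by omega) (Finset.card_pos.1 (by omega)) ?_ h
    have h1 : 0 ≤ (k : ℝ) * (m - n) := mul_nonneg (by linarith) (by linarith)
    have h2 : 0 ≤ (n : ℝ) - k + 1 := by linarith
    positivity
  · have hknr : (n : ℝ) < k := by exact_mod_cast hkn
    rw [abs_sub_comm, abs_of_pos (sub_pos.2 hknr), min_eq_right hknr.le, add_assoc,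
      show (n : ℝ) * m - n * k = n * (m - k) by ring]
    have h1 : 0 ≤ (n : ℝ) * (m - k) := mul_nonneg (Nat.cast_nonneg n) (by linarith)
    have h2 : 0 < (k : ℝ) - n + 1 := by linarith
    have hρ0 : 0 ≤ ((k : ℝ) - n + 1) / (alphaConst m n k * (n * (m - k)) + (k - n + 1)) := by
      positivity
    have hρ1 : ((k : ℝ) - n + 1) / (alphaConst m n k * (n * (m - k)) + (k - n + 1)) ≤ 1 :=
      div_le_one_of_le₀ (by nlinarith [mul_nonneg hα h1]) (by positivity)
    rcases Nat.eq_zero_or_pos n with rfl | hn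
    · -- Without rows, `minStretch Aᵀ` is an infimum over the empty sphere, hence `0`.
      obtain ⟨S, -, hS⟩ := Finset.exists_subset_card_eq
        (show k ≤ (Finset.univ : Finset (Fin m)).card by simpa using hkm)
      refine ⟨S, hS, ?_⟩
      have : IsEmpty (Metric.sphere (0 : EuclideanSpace ℝ (Fin 0)) 1) :=
        ⟨fun x => by simpa [Subsingleton.elim x.1 0] using x.2⟩
      rw [show minStretch Aᵀ = 0 from Real.iInf_of_isEmpty _]
      simpa using sq_nonneg _
    rcases hkm.eq_or_lt with rfl | hkm'
    · refine ⟨Finset.univ, by simp, le_sigmaMin_columnSubmatrix_of_lt_card hA hn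
        (by simpa using hkn) hρ0 hρ1 fun v hv => ?_⟩
      have hv0 : v = 0 := funext fun i => hv i (Finset.mem_univ i)
      simp [hv0]
    · have hQtr : (1 - rowProjection A).trace = ((m - n : ℕ) : ℝ) := by
        rw [trace_sub, trace_one, Fintype.card_fin, htr, Nat.cast_sub (by omega)]
      have hQQ : (1 - rowProjection A) * (1 - rowProjection A) = 1 - rowProjection A := by
        rw [sub_mul, one_mul, mul_sub, mul_one, hPP, sub_self, sub_zero]
      obtain ⟨T, hT, h⟩ := exists_finset_projection (Nat.sub_le m k) (isHermitian_one.sub hP) hQQ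
        hQtr fun x hx => eval_iterate_derivative_pos_of_lt hn hkn hkm' hx
      have hTc : Tᶜ.card = k := by
        rw [Finset.card_compl, hT, Fintype.card_fin]
        omega
      exact ⟨Tᶜ, hTc, le_sigmaMin_columnSubmatrix_of_lt_card hA hn (by omega) hρ0 hρ1
        fun v hv => h v fun i hi => hv i (Finset.mem_compl.2 hi)⟩
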